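/- Let $\mathbb K=\mathbb R$ or $\mathbb C$, let $n\ge 2$, let $E_1,\dots,E_n,F$ be Banach spaces over $\mathbb K$ and let $A\colon E_1\times\cdots\times E_n\to F$ be a continuous $n$-linear operator. For a finite sequence $(x_j)_{j=1}^k$ in a Banach space put $\|(x_j)_{j=1}^k\|_p=\big(\sum_{j=1}^k\|x_j\|^p\big)^{1/p}$ for $0<p<\infty$, and $\|(x_j)_{j=1}^k\|_{\mathrm{Rad}}=\big(\int_0^1\|\sum_{j=1}^k r_j(t)x_j\|^2\,dt\big)^{1/2}$, where $r_j(t)=\operatorname{sign}(\sin(2^j\pi t))$ are the Rademacher functions. For $0<p_1,\dots,p_n,q<\infty$, a continuous $n$-linear operator $T$ on $G_1\times\cdots\times G_n$ ($G_i$ Banach spaces) has *type* $(p_1,\dots,p_n)$ if there is $C>0$ such that $$\big\|\big(T(x^{(1)}_j,\dots,x^{(n)}_j)\big)_{j=1}^k\big\|_{\mathrm{Rad}}\le C\prod_{i=1}^n\|(x^{(i)}_j)_{j=1}^k\|_{p_i}$$ for all $k$ and all $x^{(i)}_1,\dots,x^{(i)}_k\in G_i$, $i=1,\dots,n$; it has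 *cotype* $q$ if there is $M>0$ such that $$\big\|\big(T(x^{(1)}_j,\dots,x^{(n)}_j)\big)_{j=1}^k\big\|_{q}\le M\prod_{i=1}^n\|(x^{(i)}_j)_{j=1}^k\|_{\mathrm{Rad}}$$ for all such choices. The tuple $(p_1,\dots,p_n)$ is a *proper type* if $\frac12\le\frac1{p_1}+\cdots+\frac1{p_n}<1$, and $q$ is a *proper cotype* if $\frac2n\le q<\infty$. Write $J_G\colon G\to G''$ for the canonical embedding into the bidual. For a permutation $\sigma$ of $\{1,\dots,n\}$, the *Aron–Berner extension* of $A$ in the order $\sigma$ is the continuous $n$-linear operator $E_1''\times\cdots\times E_n''\to F''$ that sends $(y_1,\dots,y_n)$ to the iterated weak-star limit $$\underset{\alpha_{\sigma(1)}}{w^*\text{-}\lim}\cdots\underset{\alpha_{\sigma(n)}}{w^*\text{-}\lim}\;J_F\big(A(x_{\alpha_1},\dots,x_{\alpha_n})\big),$$ where, for each $i$, $(x_{\alpha_i})$ is any net in $E_i$ such that $J_{E_i}(x_{\alpha_i})\to y_i$ weak-star; the limit does not depend on the choice of these nets. Thus $A$ has at most $n!$ different Aron–Berner extensions. **Corollary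 4.2.** Let $(p_1,\dots,p_n)$ be a proper type and let $q$ be a proper cotype. The following are equivalent: (a) $A$ has type $(p_1,\dots,p_n)$; (b) all Aron–Berner extensions of $A$ have type $(p_1,\dots,p_n)$; (c) some Aron–Berner extension of $A$ has type $(p_1,\dots,p_n)$. The same equivalence holds with "type $(p_1,\dots,p_n)$" replaced by "cotype $q$" throughout (a), (b), (c). -/

import Mathlib

open Filter Topology

noncomputable section

/-- The Rademacher functions `r₁, r₂, …` on `[0,1]`, with `rademacher j` standing for `r_{j+1}`:
`r_{j+1}(t) = sign (sin (2^{j+1} π t))`. -/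
def rademacher (j : ℕ) (t : ℝ) : ℝ :=
  Real.sign (Real.sin (2 ^ (j + 1) * Real.pi * t))

/-- The norm of a finite sequence in `Rad(E)`:
`(∫₀¹ ‖∑ⱼ rⱼ(t) xⱼ‖² dt)^{1/2}`. -/
def radNorm (𝕜 : Type*) [RCLike 𝕜] {E : Type*} [NormedAddCommGroup E] [NormedSpace 𝕜 E]
    {k : ℕ} (x : Fin k → E) : ℝ :=
  Real.sqrt (∫ t in (0 : ℝ)..1, ‖∑ j : Fin k, ((rademacher j t : ℝ) : 𝕜) • x j‖ ^ 2)

/-- The `ℓ_p`-(quasi-)norm of a finite sequence, for `0 < p < ∞`. -/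
def lpSeqNorm {E : Type*} [NormedAddCommGroup E] (p : ℝ) {k : ℕ} (x : Fin k → E) : ℝ :=
  (∑ j : Fin k, ‖x j‖ ^ p) ^ (1 / p)

section TypeCotype

variable {𝕜 : Type*} [RCLike 𝕜] {n : ℕ}
  {E : Fin n → Type*} [∀ i, NormedAddCommGroup (E i)] [∀ i, NormedSpace 𝕜 (E i)]
  {F : Type*} [NormedAddCommGroup F] [NormedSpace 𝕜 F]

/-- `T` has type `(p₁, …, pₙ)`. -/
def HasMultiType (p : Fin n → ℝ) (T : ContinuousMultilinearMap 𝕜 E F) : Prop :=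
  ∃ C : ℝ, 0 < C ∧ ∀ (k : ℕ) (x : ∀ i, Fin k → E i),
    radNorm 𝕜 (fun j => T (fun i => x i j)) ≤ C * ∏ i, lpSeqNorm (p i) (x i)

/-- `T` has cotype `q`. -/
def HasMultiCotype (q : ℝ) (T : ContinuousMultilinearMap 𝕜 E F) : Prop :=
  ∃ M : ℝ, 0 < M ∧ ∀ (k : ℕ) (x : ∀ i, Fin k → E i),
    lpSeqNorm q (fun j => T (fun i => x i j)) ≤ M * ∏ i, radNorm 𝕜 (x i)

end TypeCotype

/-- `(p₁, …, pₙ)`, with `0 < pᵢ < ∞`, is a proper type for `n`-linear operators. -/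
def IsProperType {n : ℕ} (p : Fin n → ℝ) : Prop :=
  (∀ i, 0 < p i) ∧ 1 / 2 ≤ ∑ i, 1 / p i ∧ ∑ i, 1 / p i < 1

/-- `q`, with `0 < q < ∞`, is a proper cotype for `n`-linear operators. -/
def IsProperCotype (n : ℕ) (q : ℝ) : Prop :=
  0 < q ∧ 2 / (n : ℝ) ≤ q

/-- `HasIteratedLim l f [i₁, …, iₘ] h` says that the iterated limit
`lim_{x_{i₁} → l i₁} ⋯ lim_{x_{iₘ} → l iₘ} f(x)` exists (the head of the list is the outermost
limit) and that its value, as a function of the remaining variables, is `h`. -/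
def HasIteratedLim {n : ℕ} {E : Fin n → Type*} {X : Type*} [TopologicalSpace X]
    (l : ∀ i, Filter (E i)) (f : (∀ i, E i) → X) :
    List (Fin n) → ((∀ i, E i) → X) → Prop
  | [], h => h = f
  | i :: is, h => ∃ g, HasIteratedLim l f is g ∧
      ∀ x : ∀ i, E i, Tendsto (fun t : E i => g (Function.update x i t)) (l i) (𝓝 (h x))

section AronBerner

variable {𝕜 : Type*} [RCLike 𝕜] {n : ℕ}
  {E : Fin n → Type*} [∀ i, NormedAddCommGroup (E i)] [∀ i, NormedSpace 𝕜 (E i)]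
  {F : Type*} [NormedAddCommGroup F] [NormedSpace 𝕜 F]

/-- The bidual `G''` of a normed space, with its norm. -/
abbrev Bidual (𝕜 : Type*) [RCLike 𝕜] (G : Type*) [NormedAddCommGroup G] [NormedSpace 𝕜 G] :
    Type _ :=
  StrongDual 𝕜 (StrongDual 𝕜 G)

/-- The canonical embedding `J_G : G → G''`, with `G''` carrying its weak-star topology. -/
def bidualEmb (𝕜 : Type*) [RCLike 𝕜] (G : Type*) [NormedAddCommGroup G] [NormedSpace 𝕜 G]
    (x : G) : WeakDual 𝕜 (StrongDual 𝕜 G) :=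
  StrongDual.toWeakDual (NormedSpace.inclusionInDoubleDual 𝕜 G x)

/-- `B : E₁'' × ⋯ × Eₙ'' → F''` is the Aron-Berner extension of `A` for the order `σ`: for all
`yᵢ ∈ Eᵢ''` and all nets in `Eᵢ` that converge weak-star to `yᵢ`, the iterated weak-star limit
of `J_F ∘ A` along these nets, taken in the order `σ 0` (outermost), …, `σ (n-1)` (innermost), is
`B(y₁, …, yₙ)`. A net enters through its filter of tails; these are the proper filters on `Eᵢ`. -/
def IsAronBernerExtensionInOrder (σ : Equiv.Perm (Fin n)) (A : ContinuousMultilinearMap 𝕜 E F)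
    (B : ContinuousMultilinearMap 𝕜 (fun i => Bidual 𝕜 (E i)) (Bidual 𝕜 F)) : Prop :=
  ∀ (y : ∀ i, Bidual 𝕜 (E i)) (l : ∀ i, Filter (E i)),
    (∀ i, (l i).NeBot) →
    (∀ i, Tendsto (bidualEmb 𝕜 (E i)) (l i) (𝓝 (StrongDual.toWeakDual (y i)))) →
    HasIteratedLim l (fun x => bidualEmb 𝕜 F (A x)) (List.ofFn σ)
      (fun _ => StrongDual.toWeakDual (B y))

/-- `B` is one of the (at most `n!`) Aron-Berner extensions of `A`. -/
def IsAronBernerExtension (A : ContinuousMultilinearMap 𝕜 E F)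
    (B : ContinuousMultilinearMap 𝕜 (fun i => Bidual 𝕜 (E i)) (Bidual 𝕜 F)) : Prop :=
  ∃ σ : Equiv.Perm (Fin n), IsAronBernerExtensionInOrder σ A B

end AronBerner

end

/-! Let `y i` be tuples in the biduals. Each `y i` is a weak-star limit, along one filter on `Fin k
→ E i`, of tuples of `E i` whose `ℓ_p` or Rademacher norm is controlled by that of `y i`. The
coordinates of these tuples converge separately, so the Aron-Berner limits can be taken for all `j`
at once. Bounds on the target norm define weak-star closed sets, since dual norms are weak-star
lower semicontinuous; hence the inequality for `A` survives every limit
(`HasIteratedLim.mem_of_isClosed`).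

For `ℓ_p` the approximation is Goldstine's theorem in each coordinate. For the Rademacher norm the
tuple must be approximated as a whole (`exists_filter_tendsto_radNorm_le`): this norm is that of a
finite `ℓ₂`-sum pulled back by a linear map, and Hahn-Banach applies.

Conversely an extension restricts to `A` along the isometric embeddings. Passing from "all" to
"some" requires an extension to exist (`exists_isAronBernerExtension`). -/

noncomputable section

/-! ### Iterated limits and closed sets -/

section IteratedLimits

variable {n : ℕ} {E : Fin n → Type*} {X : Type*} [TopologicalSpace X]

/-- Simultaneous iterated limits of a family `(f (x · j))ⱼ` stay in a closed set which contains
all values of the family over a prescribed product of sets. -/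
theorem HasIteratedLim.mem_of_isClosed {ι : Type*} {K : Set (ι → X)} (hK : IsClosed K)
    {S : ∀ i, Set (ι → E i)} {L : ∀ i, Filter (ι → E i)} (hL : ∀ i, (L i).NeBot)
    (hS : ∀ i, S i ∈ L i) {f : (∀ i, E i) → X}
    (hf : ∀ x : ∀ i, ι → E i, (∀ i, x i ∈ S i) → (fun j => f (fun i => x i j)) ∈ K)
    (is : List (Fin n)) (h : ι → (∀ i, E i) → X)
    (hh : ∀ j, HasIteratedLim (fun i => map (fun x : ι → E i => x j) (L i)) f is (h j))
    (x : ∀ i, ι → E i) (hx : ∀ i, x i ∈ S i) :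
    (fun j => h j (fun i => x i j)) ∈ K := by
  induction is generalizing h x with
  | nil =>
    have : h = fun _ => f := funext fun j => hh j
    subst this
    exact hf x hx
  | cons i is ih =>
    choose g hg hlim using hh
    have := hL i
    -- The `i`-th variable of all coordinates moves together along `L i`; each coordinate sees only
    -- its marginal filter.
    refine hK.mem_of_tendsto (b := L i)
      (f := fun t j => g j (fun i' => Function.update x i t i' j)) ?_ ?_
    · rw [tendsto_pi_nhds]
      intro j
      have h1 := hlim j (fun i' => x i' j)
      rw [tendsto_map'_iff] at h1
      refine h1.congr fun t => ?_
      simp only [Function.comp]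
      congr 1
      ext i'
      rcases eq_or_ne i' i with rfl | hne
      · simp
      · simp [hne]
    · filter_upwards [hS i] with t ht
      refine ih g hg (Function.update x i t) fun i' => ?_
      rcases eq_or_ne i' i with rfl | hne
      · simpa using ht
      · simpa [hne] using hx i'

/-- Pure filters are constant nets, so every limit is an evaluation; this is what makes Aron-Berner
extensions extend `A`. -/
theorem HasIteratedLim.eq_of_pure [T2Space X] {f : (∀ i, E i) → X} (a : ∀ i, E i)
    (is : List (Fin n)) (h : (∀ i, E i) → X)
    (hh : HasIteratedLim (fun i => pure (a i)) f is h) (x : ∀ i, E i) :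
    h x = f (fun i => if i ∈ is then a i else x i) := by
  induction is generalizing h x with
  | nil => rw [show h = f from hh]; simp
  | cons i is ih =>
    obtain ⟨g, hg, hlim⟩ := hh
    have h1 := tendsto_nhds_unique (hlim x) (tendsto_pure_nhds _ (a i))
    rw [h1, ih g hg]
    congr 1
    ext i'
    rcases eq_or_ne i' i with rfl | hne
    · simp
    · simp [hne]

end IteratedLimits

/-! ### The Rademacher norm as a finite `ℓ₂`-norm -/

section Rademacher

/-- The vector of signs of the first `k` Rademacher functions at `t`. -/
def radSign (k : ℕ) (t : ℝ) (j : Fin k) : SignType :=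
  SignType.sign (Real.sin (2 ^ ((j : ℕ) + 1) * Real.pi * t))

theorem rademacher_eq_radSign {k : ℕ} (j : Fin k) (t : ℝ) :
    rademacher j t = (radSign k t j : ℝ) := by
  unfold rademacher radSign Real.sign
  rcases lt_trichotomy (Real.sin (2 ^ ((j : ℕ) + 1) * Real.pi * t)) 0 with h | h | h
  · simp [h]
  · simp [h]
  · simp [h, h.not_gt]

theorem measurableSet_radSign_preimage {k : ℕ} (s : Fin k → SignType) :
    MeasurableSet (radSign k ⁻¹' {s}) := by
  have : radSign k ⁻¹' {s} = ⋂ j, {t | radSign k t j = s j} := by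
    ext t; simp [funext_iff]
  rw [this]
  refine MeasurableSet.iInter fun j => ?_
  have hm : Measurable fun t : ℝ => Real.sin (2 ^ ((j : ℕ) + 1) * Real.pi * t) := by fun_prop
  rcases h : s j with _ | _ | _
  · convert hm (measurableSet_singleton (0 : ℝ)) using 1
    ext t; simp [radSign]
  · convert hm (measurableSet_Iio (a := (0 : ℝ))) using 1
    ext t; simp [radSign, sign_eq_neg_one_iff]
  · convert hm (measurableSet_Ioi (a := (0 : ℝ))) using 1
    ext t; simp [radSign, sign_eq_one_iff]

/-- The probability that the first `k` Rademacher functions take the values `s`. -/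
def radWeight (k : ℕ) (s : Fin k → SignType) : ℝ :=
  (MeasureTheory.volume.restrict (Set.Ioc (0 : ℝ) 1)).real (radSign k ⁻¹' {s})

theorem radWeight_nonneg (k : ℕ) (s : Fin k → SignType) : 0 ≤ radWeight k s :=
  MeasureTheory.measureReal_nonneg

variable (𝕜 : Type*) [RCLike 𝕜] {E : Type*} [NormedAddCommGroup E] [NormedSpace 𝕜 E]

/-- The weighted sign sum `√(w s) ∑ⱼ sⱼ xⱼ`. -/
def radComb {k : ℕ} (s : Fin k → SignType) (x : Fin k → E) : E :=
  ∑ j, ((√(radWeight k s) * (s j : ℝ) : ℝ) : 𝕜) • x j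

/-- The integrand depends only on the sign pattern, which takes finitely many values. The actual
weights never matter. -/
theorem integral_comp_radSign (k : ℕ) (g : (Fin k → SignType) → ℝ) :
    ∫ t in (0 : ℝ)..1, g (radSign k t) = ∑ s, radWeight k s * g s := by
  rw [intervalIntegral.integral_of_le zero_le_one]
  have h : ∀ t, g (radSign k t) = ∑ s, (radSign k ⁻¹' {s}).indicator (fun _ => g s) t := by
    intro t
    rw [Finset.sum_eq_single (radSign k t)]
    · simp
    · intro s _ hs
      simp [Set.indicator, hs.symm]
    · simp
  simp_rw [h]
  rw [MeasureTheory.integral_finsetSum]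
  · refine Finset.sum_congr rfl fun s _ => ?_
    rw [MeasureTheory.integral_indicator_const _ (measurableSet_radSign_preimage s), smul_eq_mul,
      radWeight]
  · intro s _
    exact (MeasureTheory.integrable_const _).indicator (measurableSet_radSign_preimage s)

theorem radNorm_eq {k : ℕ} (x : Fin k → E) :
    radNorm 𝕜 x = √(∑ s, ‖radComb 𝕜 s x‖ ^ 2) := by
  unfold radNorm
  simp_rw [rademacher_eq_radSign]
  rw [integral_comp_radSign k fun s => ‖∑ j, ((s j : ℝ) : 𝕜) • x j‖ ^ 2]
  congr 1
  refine Finset.sum_congr rfl fun s _ => ?_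
  have : radComb 𝕜 s x = ((√(radWeight k s) : ℝ) : 𝕜) • ∑ j, ((s j : ℝ) : 𝕜) • x j := by
    simp [radComb, Finset.smul_sum, mul_smul]
  rw [this, norm_smul, mul_pow, RCLike.norm_ofReal, sq_abs, Real.sq_sqrt (radWeight_nonneg k s)]

theorem radNorm_inclusionInDoubleDual {k : ℕ} (x : Fin k → E) :
    radNorm 𝕜 (fun j => NormedSpace.inclusionInDoubleDual 𝕜 E (x j)) = radNorm 𝕜 x := by
  unfold radNorm
  simp_rw [← map_smul, ← map_sum]
  congr 2
  ext t
  rw [show ∀ z : E, ‖NormedSpace.inclusionInDoubleDual 𝕜 E z‖ = ‖z‖ from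
    (NormedSpace.inclusionInDoubleDualLi 𝕜).norm_map]

theorem lpSeqNorm_inclusionInDoubleDual (p : ℝ) {k : ℕ} (x : Fin k → E) :
    lpSeqNorm p (fun j => NormedSpace.inclusionInDoubleDual 𝕜 E (x j)) = lpSeqNorm p x := by
  unfold lpSeqNorm
  simp_rw [show ∀ z : E, ‖NormedSpace.inclusionInDoubleDual 𝕜 E z‖ = ‖z‖ from
    (NormedSpace.inclusionInDoubleDualLi 𝕜).norm_map]

theorem radNorm_nonneg {k : ℕ} (x : Fin k → E) : 0 ≤ radNorm 𝕜 x := Real.sqrt_nonneg _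

theorem lpSeqNorm_nonneg (p : ℝ) {k : ℕ} (x : Fin k → E) : 0 ≤ lpSeqNorm p x := by
  unfold lpSeqNorm; positivity

end Rademacher

/-! ### Weak-star lower semicontinuity of the sequence norms -/

section LowerSemicontinuity

variable (𝕜 : Type*) [RCLike 𝕜] {G : Type*} [NormedAddCommGroup G] [NormedSpace 𝕜 G]

theorem WeakDual.lowerSemicontinuous_norm :
    LowerSemicontinuous fun z : WeakDual 𝕜 G => ‖WeakDual.toStrongDual z‖ := by
  rw [lowerSemicontinuous_iff_isClosed_preimage]
  intro r
  convert WeakDual.isClosed_closedBall (𝕜 := 𝕜) (0 : StrongDual 𝕜 G) r using 1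
  ext z
  simp

theorem lowerSemicontinuous_rpow_const {X : Type*} [TopologicalSpace X] {f : X → ℝ}
    (hf : LowerSemicontinuous f) (hf0 : ∀ x, 0 ≤ f x) {p : ℝ} (hp : 0 ≤ p) :
    LowerSemicontinuous fun x => f x ^ p := by
  -- Truncating at `0` makes the power continuous and monotone on the whole line.
  have h := Continuous.comp_lowerSemicontinuous (g := fun t : ℝ => (max t 0) ^ p)
    ((continuous_id.max continuous_const).rpow_const fun _ => Or.inr hp) hf
    fun a b hab => Real.rpow_le_rpow (le_max_right _ _) (max_le_max_right 0 hab) hp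
  simpa [Function.comp_def, hf0] using h

theorem isClosed_lpSeqNorm_le {p : ℝ} (hp : 0 < p) (k : ℕ) (c : ℝ) :
    IsClosed {w : Fin k → WeakDual 𝕜 G | lpSeqNorm p (fun j => WeakDual.toStrongDual (w j)) ≤ c} := by
  have h : LowerSemicontinuous fun w : Fin k → WeakDual 𝕜 G =>
      lpSeqNorm p (fun j => WeakDual.toStrongDual (w j)) := by
    refine lowerSemicontinuous_rpow_const (lowerSemicontinuous_sum fun j _ =>
      lowerSemicontinuous_rpow_const ?_ (fun _ => norm_nonneg _) hp.le)
      (fun _ => by positivity) (by positivity)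
    exact (WeakDual.lowerSemicontinuous_norm 𝕜).comp (continuous_apply j)
  exact lowerSemicontinuous_iff_isClosed_preimage.1 h c

theorem isClosed_radNorm_le (k : ℕ) (c : ℝ) :
    IsClosed {w : Fin k → WeakDual 𝕜 G | radNorm 𝕜 (fun j => WeakDual.toStrongDual (w j)) ≤ c} := by
  have h : LowerSemicontinuous fun w : Fin k → WeakDual 𝕜 G =>
      radNorm 𝕜 (fun j => WeakDual.toStrongDual (w j)) := by
    simp_rw [radNorm_eq, Real.sqrt_eq_rpow, ← Real.rpow_natCast]
    refine lowerSemicontinuous_rpow_const (lowerSemicontinuous_sum fun s _ =>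
      lowerSemicontinuous_rpow_const ?_ (fun _ => norm_nonneg _) (by positivity))
      (fun _ => by positivity) (by positivity)
    have hc : Continuous fun w : Fin k → WeakDual 𝕜 G =>
        ∑ j, ((√(radWeight k s) * (s j : ℝ) : ℝ) : 𝕜) • w j := by fun_prop
    convert (WeakDual.lowerSemicontinuous_norm 𝕜).comp hc using 2 with w
    simp [radComb]
  exact lowerSemicontinuous_iff_isClosed_preimage.1 h c

end LowerSemicontinuity

/-! ### Goldstine theorems with norm control -/

section Approximation

variable {𝕜 : Type*} [RCLike 𝕜] {E : Type*} [NormedAddCommGroup E] [NormedSpace 𝕜 E]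

instance WeakDual.locallyConvexSpace_real :
    LocallyConvexSpace ℝ (WeakDual 𝕜 (StrongDual 𝕜 E)) :=
  (WeakDual.withSeminorms 𝕜 (StrongDual 𝕜 E)).toLocallyConvexSpace

/-- Continuous functionals on a finite power of a weak-star dual are given by predual vectors. -/
theorem WeakDual.exists_pi_functional {G : Type*} [NormedAddCommGroup G] [NormedSpace 𝕜 G]
    {ι : Type*} [Fintype ι] (f : StrongDual 𝕜 (ι → WeakDual 𝕜 G)) :
    ∃ φ : ι → G, ∀ z, f z = ∑ j, z j (φ j) := by
  classical
  have h : ∀ j, ∃ φ : G, ∀ z : WeakDual 𝕜 G, f (Pi.single j z) = z φ := by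
    intro j
    obtain ⟨φ, hφ⟩ := LinearMap.dualEmbedding_surjective (topDualPairing 𝕜 G)
      (f.comp (ContinuousLinearMap.single 𝕜 (fun _ : ι => WeakDual 𝕜 G) j))
    exact ⟨φ, fun z => (DFunLike.congr_fun hφ z).symm⟩
  choose φ hφ using h
  refine ⟨φ, fun z => ?_⟩
  conv_lhs => rw [← Finset.univ_sum_single z]
  simp [hφ]

/-- A Goldstine type theorem for finite powers: a tuple in the bidual which is dominated by the
seminorm `N` in the sense of duality is a weak-star limit of tuples `x` with `N x ≤ r`. -/
theorem exists_filter_tendsto_of_dual_bound {ι : Type*} [Fintype ι] (N : Seminorm 𝕜 (ι → E))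
    (y : ι → Bidual 𝕜 E) {r : ℝ} (hr : 0 < r)
    (hy : ∀ φ : ι → StrongDual 𝕜 E, (∀ x : ι → E, ‖∑ j, φ j (x j)‖ ≤ N x) →
      ‖∑ j, y j (φ j)‖ ≤ r) :
    ∃ L : Filter (ι → E), L.NeBot ∧
      (∀ j, Tendsto (fun x => bidualEmb 𝕜 E (x j)) L (𝓝 (StrongDual.toWeakDual (y j)))) ∧
      {x | N x ≤ r} ∈ L := by
  set Φ : (ι → E) → (ι → WeakDual 𝕜 (StrongDual 𝕜 E)) := fun x j => bidualEmb 𝕜 E (x j) with hΦ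
  set S : Set (ι → E) := {x | N x ≤ r} with hS
  set w : ι → WeakDual 𝕜 (StrongDual 𝕜 E) := fun j => StrongDual.toWeakDual (y j) with hw
  have hmem : w ∈ closure (Φ '' S) := by
    by_contra hcon
    have hconv : Convex ℝ (Φ '' S) := by
      rintro _ ⟨x, hx, rfl⟩ _ ⟨x', hx', rfl⟩ a b ha hb hab
      refine ⟨fun j => (a : 𝕜) • x j + (b : 𝕜) • x' j, ?_, ?_⟩
      · have h1 : N ((a : 𝕜) • x + (b : 𝕜) • x') ≤ a * N x + b * N x' := by
          refine (map_add_le_add N _ _).trans_eq ?_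
          rw [map_smul_eq_mul, map_smul_eq_mul, RCLike.norm_ofReal, RCLike.norm_ofReal,
            abs_of_nonneg ha, abs_of_nonneg hb]
        refine h1.trans ?_
        calc a * N x + b * N x' ≤ a * r + b * r :=
              add_le_add (mul_le_mul_of_nonneg_left hx ha) (mul_le_mul_of_nonneg_left hx' hb)
          _ = r := by rw [← add_mul, hab, one_mul]
      · ext j
        refine ContinuousLinearMap.ext fun φ => ?_
        change φ ((a : 𝕜) • x j + (b : 𝕜) • x' j) = a • φ (x j) + b • φ (x' j)
        simp [RCLike.real_smul_eq_coe_mul]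
    obtain ⟨f, u, hfu, huw⟩ := RCLike.geometric_hahn_banach_closed_point (𝕜 := 𝕜)
      hconv.closure isClosed_closure hcon
    obtain ⟨φ, hφ⟩ := WeakDual.exists_pi_functional f
    have hφ' : ∀ x ∈ S, RCLike.re (∑ j, φ j (x j)) < u := by
      intro x hx
      have := hfu _ (subset_closure ⟨x, hx, rfl⟩)
      rw [hφ] at this
      exact this
    -- The origin lies in `S` and `f` vanishes there.
    have hu : 0 < u := by simpa using hφ' 0 (by simp [hS, hr.le])
    have hb : ∀ x ∈ S, ‖∑ j, φ j (x j)‖ ≤ u := by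
      intro x hx
      -- `S` is invariant under unimodular scalars, so a bound on real parts bounds the modulus.
      obtain ⟨c, hc, hcx⟩ := RCLike.exists_norm_eq_mul_self (∑ j, φ j (x j))
      have h1 := hφ' (c • x) (by simpa [hS, map_smul_eq_mul, hc] using hx)
      have h2 : ∑ j, φ j ((c • x) j) = c * ∑ j, φ j (x j) := by simp [Finset.mul_sum]
      rw [h2, ← hcx, RCLike.ofReal_re] at h1
      exact h1.le
    have hb' : ∀ x, ‖∑ j, φ j (x j)‖ ≤ u / r * N x := by
      intro x
      -- The bound follows by scaling `x` into `S`; the slack `δ` covers `N x = 0`.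
      refine le_of_forall_pos_le_add fun ε hε => ?_
      obtain ⟨δ, hδ, hδε⟩ : ∃ δ : ℝ, 0 < δ ∧ u / r * δ = ε :=
        ⟨ε / (u / r), by positivity, by field_simp⟩
      have hpos : 0 < N x + δ := add_pos_of_nonneg_of_pos (apply_nonneg N x) hδ
      set c : ℝ := r / (N x + δ) with hc
      have hcpos : 0 < c := by positivity
      have hxS : ((c : ℝ) : 𝕜) • x ∈ S := by
        change N _ ≤ r
        rw [map_smul_eq_mul, RCLike.norm_ofReal, abs_of_pos hcpos, hc, div_mul_eq_mul_div, div_le_iff₀ hpos]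
        exact mul_le_mul_of_nonneg_left (by linarith) hr.le
      have h1 := hb _ hxS
      have h2 : ∑ j, φ j (((c : 𝕜) • x) j) = (c : 𝕜) * ∑ j, φ j (x j) := by simp [Finset.mul_sum]
      rw [h2, norm_mul, RCLike.norm_ofReal, abs_of_pos hcpos, hc, div_mul_eq_mul_div,
        div_le_iff₀ hpos] at h1
      rw [← hδε, ← mul_add, div_mul_eq_mul_div, le_div_iff₀ hr]
      linarith
    have hur : 0 < u / r := by positivity
    -- The rescaled functionals satisfy the hypothesis of `hy`, giving `‖∑ j, y j (φ j)‖ ≤ u`,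
    -- against the separation `huw`.
    have h3 := hy (fun j => (((u / r)⁻¹ : ℝ) : 𝕜) • φ j) (fun x => by
      have h4 : ∑ j, ((((u / r)⁻¹ : ℝ) : 𝕜) • φ j) (x j) =
          (((u / r)⁻¹ : ℝ) : 𝕜) * ∑ j, φ j (x j) := by simp [Finset.mul_sum]
      rw [h4, norm_mul, RCLike.norm_ofReal, abs_of_pos (inv_pos.2 hur), inv_mul_le_iff₀ hur]
      exact hb' x)
    have h4 : ∑ j, y j ((((u / r)⁻¹ : ℝ) : 𝕜) • φ j) =
          (((u / r)⁻¹ : ℝ) : 𝕜) * ∑ j, y j (φ j) := by simp [Finset.mul_sum]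
    rw [h4, norm_mul, RCLike.norm_ofReal, abs_of_pos (inv_pos.2 hur), inv_mul_le_iff₀ hur,
      div_mul_cancel₀ _ hr.ne'] at h3
    rw [hφ] at huw
    exact absurd ((RCLike.re_le_norm _).trans h3) (not_le.2 huw)
  refine ⟨comap Φ (𝓝 w) ⊓ 𝓟 S, ?_, fun j => ?_, mem_inf_of_right (mem_principal_self S)⟩
  · rw [mem_closure_iff_clusterPt, ClusterPt, ← map_principal, ← Filter.push_pull'] at hmem
    exact map_neBot_iff Φ |>.1 hmem
  · have h1 : Tendsto Φ (comap Φ (𝓝 w) ⊓ 𝓟 S) (𝓝 w) := tendsto_comap.mono_left inf_le_left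
    exact tendsto_pi_nhds.1 h1 j

/-- **Goldstine's theorem**, with a norm control by the norm of the limit. -/
theorem exists_filter_tendsto_norm_le (y : Bidual 𝕜 E) :
    ∃ L : Filter E, L.NeBot ∧
      Tendsto (bidualEmb 𝕜 E) L (𝓝 (StrongDual.toWeakDual y)) ∧ {x | ‖x‖ ≤ ‖y‖} ∈ L := by
  -- The general result needs a positive radius.
  rcases eq_or_ne y 0 with rfl | hy
  · refine ⟨pure 0, inferInstance, ?_, (norm_zero (E := E)).trans_le (norm_nonneg (0 : Bidual 𝕜 E))⟩
    have : StrongDual.toWeakDual (0 : Bidual 𝕜 E) = bidualEmb 𝕜 E 0 := by simp [bidualEmb]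
    rw [this]
    exact tendsto_pure_nhds _ _
  · have hpos : 0 < ‖y‖ := by
      have h := norm_pos_iff (a := y)
      exact h.2 hy
    obtain ⟨L, hL, hlim, hS⟩ := exists_filter_tendsto_of_dual_bound
      ((normSeminorm 𝕜 E).comp (LinearMap.proj () : (Unit → E) →ₗ[𝕜] E)) (fun _ => y)
      (r := ‖y‖) hpos (fun φ hφ => by
        have h1 : ‖φ ()‖ ≤ 1 := ContinuousLinearMap.opNorm_le_bound _ zero_le_one fun x => by
          simpa using hφ fun _ => x
        rw [Fintype.sum_unique]
        exact y.unit_le_opNorm _ h1)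
    refine ⟨map (fun x : Unit → E => x ()) L, inferInstance, ?_, hS⟩
    exact Filter.tendsto_map' (f := bidualEmb 𝕜 E) (hlim ())

theorem exists_filter_tendsto_lpSeqNorm_le {p : ℝ} (hp : 0 < p) {k : ℕ}
    (y : Fin k → Bidual 𝕜 E) :
    ∃ L : Filter (Fin k → E), L.NeBot ∧
      (∀ j, Tendsto (fun x => bidualEmb 𝕜 E (x j)) L (𝓝 (StrongDual.toWeakDual (y j)))) ∧
      {x | lpSeqNorm p x ≤ lpSeqNorm p y} ∈ L := by
  choose L hL hlim hS using fun j => exists_filter_tendsto_norm_le (y j)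
  refine ⟨Filter.pi L, inferInstance, fun j => (hlim j).comp (tendsto_eval_pi L j), ?_⟩
  have : ∀ᶠ x in Filter.pi L, ∀ j, ‖x j‖ ≤ ‖y j‖ :=
    eventually_all.2 fun j => (tendsto_eval_pi L j).eventually (hS j)
  filter_upwards [this] with x hx
  unfold lpSeqNorm
  refine Real.rpow_le_rpow (by positivity) (Finset.sum_le_sum fun j _ => ?_) (by positivity)
  exact Real.rpow_le_rpow (norm_nonneg _) (hx j) hp.le

/-- The pairing of a tuple in the bidual with a functional on an `ℓ₂`-sum. -/
theorem norm_sum_bidual_apply_le {a : Type*} [Fintype a] [DecidableEq a]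
    (g : a → StrongDual 𝕜 E) {C : ℝ} (hC : 0 ≤ C)
    (hg : ∀ x : a → E, ‖∑ s, g s (x s)‖ ≤ C * √(∑ s, ‖x s‖ ^ 2)) (z : a → Bidual 𝕜 E) :
    ‖∑ s, z s (g s)‖ ≤ C * √(∑ s, ‖z s‖ ^ 2) := by
  choose L hL hlim hS using fun s => exists_filter_tendsto_norm_le (z s)
  have hlim' : Tendsto (fun x : a → E => ‖∑ s, g s (x s)‖) (Filter.pi L)
      (𝓝 ‖∑ s, z s (g s)‖) := by
    refine (tendsto_finsetSum _ fun s _ => ?_).norm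
    exact (((WeakDual.eval_continuous (g s)).tendsto _).comp (hlim s)).comp (tendsto_eval_pi L s)
  refine le_of_tendsto hlim' ?_
  have : ∀ᶠ x in Filter.pi L, ∀ s, ‖x s‖ ≤ ‖z s‖ :=
    eventually_all.2 fun s => (tendsto_eval_pi L s).eventually (hS s)
  filter_upwards [this] with x hx
  refine (hg x).trans (mul_le_mul_of_nonneg_left (Real.sqrt_le_sqrt ?_) hC)
  exact Finset.sum_le_sum fun s _ => pow_le_pow_left₀ (norm_nonneg _) (hx s) 2

/-- The map `x ↦ (√(w s) ∑ⱼ sⱼ xⱼ)ₛ` into the `ℓ₂`-sum, whose norm is the Rademacher norm. -/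
def radMap (𝕜 : Type*) [RCLike 𝕜] (E : Type*) [NormedAddCommGroup E] [NormedSpace 𝕜 E] (k : ℕ) :
    (Fin k → E) →ₗ[𝕜] PiLp 2 (fun _ : Fin k → SignType => E) where
  toFun x := WithLp.toLp 2 fun s => radComb 𝕜 s x
  map_add' x x' := by
    ext s; simp [radComb, Finset.sum_add_distrib]
  map_smul' c x := by
    ext s; simp only [radComb, Pi.smul_apply, RingHom.id_apply, PiLp.smul_apply, Finset.smul_sum]
    exact Finset.sum_congr rfl fun j _ => smul_comm _ _ _

theorem norm_radMap {k : ℕ} (x : Fin k → E) : ‖radMap 𝕜 E k x‖ = radNorm 𝕜 x := by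
  rw [radNorm_eq, PiLp.norm_eq_of_L2]; rfl

/-- A functional dominated by the norm of the image under a linear map factors through that map
with the same bound. -/
theorem exists_factor_of_norm_le {V W : Type*} [AddCommGroup V] [Module 𝕜 V]
    [NormedAddCommGroup W] [NormedSpace 𝕜 W] (P : V →ₗ[𝕜] W) (φ : V →ₗ[𝕜] 𝕜)
    (h : ∀ x, ‖φ x‖ ≤ ‖P x‖) :
    ∃ g : StrongDual 𝕜 W, ‖g‖ ≤ 1 ∧ ∀ x, g (P x) = φ x := by
  -- `Q` is a merely linear section; continuity of `φ ∘ Q` on the range comes from `h`, which also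
  -- makes `φ` vanish on the kernel of `P`.
  obtain ⟨Q, hQ⟩ := P.rangeRestrict.exists_rightInverse_of_surjective P.range_rangeRestrict
  have hQ' : ∀ v : LinearMap.range P, P (Q v) = v := fun v =>
    congrArg Subtype.val (LinearMap.congr_fun hQ v)
  let g₀ : StrongDual 𝕜 (LinearMap.range P) := (φ ∘ₗ Q).mkContinuous 1 fun v => by
    simpa [hQ'] using h (Q v)
  obtain ⟨g, hg, hgn⟩ := exists_extension_norm_eq (LinearMap.range P) g₀
  refine ⟨g, hgn.trans_le (LinearMap.mkContinuous_norm_le _ zero_le_one _), fun x => ?_⟩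
  have h1 := hg ⟨P x, LinearMap.mem_range_self P x⟩
  have h2 := h (Q ⟨P x, LinearMap.mem_range_self P x⟩ - x)
  rw [map_sub, map_sub, hQ', sub_self, norm_zero, norm_le_zero_iff, sub_eq_zero] at h2
  exact h1.trans h2

/-- A functional dominated by `radNorm` factors through `radMap`, hence is given by a contractive
family `γ` on the `ℓ₂`-sum. Pairing it with `y` means pairing `γ` with the vectors `radComb 𝕜 s y`,
whose `ℓ₂`-norm is `radNorm 𝕜 y`. Strictness in `hr` guarantees `0 < r`. -/
theorem exists_filter_tendsto_radNorm_le {k : ℕ} (y : Fin k → Bidual 𝕜 E) {r : ℝ}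
    (hr : radNorm 𝕜 y < r) :
    ∃ L : Filter (Fin k → E), L.NeBot ∧
      (∀ j, Tendsto (fun x => bidualEmb 𝕜 E (x j)) L (𝓝 (StrongDual.toWeakDual (y j)))) ∧
      {x | radNorm 𝕜 x ≤ r} ∈ L := by
  have hN : ∀ x, (normSeminorm 𝕜 _).comp (radMap 𝕜 E k) x = radNorm 𝕜 x := norm_radMap
  suffices h : ∀ φ : Fin k → StrongDual 𝕜 E,
      (∀ x : Fin k → E, ‖∑ j, φ j (x j)‖ ≤ radNorm 𝕜 x) → ‖∑ j, y j (φ j)‖ ≤ r by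
    simpa only [hN] using exists_filter_tendsto_of_dual_bound
      ((normSeminorm 𝕜 _).comp (radMap 𝕜 E k)) y ((radNorm_nonneg 𝕜 y).trans_lt hr)
      (by simpa only [hN] using h)
  intro φ hφ
  obtain ⟨g, hg, hgφ⟩ := exists_factor_of_norm_le (radMap 𝕜 E k)
    (∑ j, (φ j).toLinearMap ∘ₗ LinearMap.proj j) (fun x => by simpa [norm_radMap] using hφ x)
  let γ : (Fin k → SignType) → StrongDual 𝕜 E := fun s =>
    g.comp ((PiLp.continuousLinearEquiv 2 𝕜
      (fun _ : Fin k → SignType => E)).symm.toContinuousLinearMap.comp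
      (ContinuousLinearMap.single 𝕜 (fun _ : Fin k → SignType => E) s))
  have hγ : ∀ x : (Fin k → SignType) → E, ∑ s, γ s (x s) = g (WithLp.toLp 2 x) := by
    intro x
    have h1 : WithLp.toLp 2 x = ∑ s, WithLp.toLp 2 (Pi.single s (x s)) := by
      conv_lhs => rw [← Finset.univ_sum_single x]
      rw [← WithLp.toLp_sum]
    rw [h1, map_sum]
    rfl
  have hφγ : ∀ j, φ j = ∑ s, ((√(radWeight k s) * (s j : ℝ) : ℝ) : 𝕜) • γ s := by
    intro j
    ext x
    have h1 := hgφ (Pi.single j x)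
    have h2 : (∑ j, (φ j).toLinearMap ∘ₗ LinearMap.proj j : (Fin k → E) →ₗ[𝕜] 𝕜)
        (Pi.single j x) = φ j x := by
      simp only [LinearMap.sum_apply, LinearMap.comp_apply, LinearMap.proj_apply]
      rw [Finset.sum_eq_single j]
      · simp
      · intro i _ hi; simp [hi]
      · simp
    rw [← h2, ← h1, radMap, LinearMap.coe_mk, AddHom.coe_mk, ← hγ]
    simp only [_root_.sum_apply, _root_.smul_apply]
    refine Finset.sum_congr rfl fun s _ => ?_
    rw [radComb, Finset.sum_eq_single j]
    · simp
    · intro i _ hi; simp [hi]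
    · simp
  have hpair : ∑ j, y j (φ j) = ∑ s, (radComb 𝕜 s y) (γ s) := by
    simp only [hφγ, map_sum, radComb, _root_.sum_apply]
    rw [Finset.sum_comm]
    simp
  rw [hpair]
  refine (norm_sum_bidual_apply_le γ zero_le_one (fun x => ?_) _).trans ?_
  · rw [hγ]
    refine (g.le_opNorm _).trans (mul_le_mul hg ?_ (norm_nonneg _) zero_le_one)
    rw [PiLp.norm_eq_of_L2]
  · rw [one_mul, ← radNorm_eq]
    exact hr.le

end Approximation

/-! ### Existence of an Aron-Berner extension -/

section Existence

set_option maxSynthPendingDepth 6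

universe u v w

variable {𝕜 : Type w} [RCLike 𝕜]

/-- Post-composition with functionals: `g ↦ (y ↦ g ∘ M y)` for `M : Y → L(D, G)`. -/
def dualPostcomp {D G Y : Type*} [NormedAddCommGroup D] [NormedSpace 𝕜 D]
    [NormedAddCommGroup G] [NormedSpace 𝕜 G] [NormedAddCommGroup Y] [NormedSpace 𝕜 Y]
    (M : Y →L[𝕜] D →L[𝕜] G) : StrongDual 𝕜 G →L[𝕜] Y →L[𝕜] StrongDual 𝕜 D :=
  ((ContinuousLinearMap.compL 𝕜 Y (D →L[𝕜] G) (D →L[𝕜] 𝕜)).flip M).comp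
    (ContinuousLinearMap.compL 𝕜 D G 𝕜)

/-- The canonical map from the bidual of `L(E, F)` to the operators between biduals,
`Ω ↦ (y ↦ (φ ↦ Ω (S ↦ y (φ ∘ S))))`. -/
def bidualHomMap (𝕜 : Type*) [RCLike 𝕜] (E : Type*) [NormedAddCommGroup E] [NormedSpace 𝕜 E]
    (F : Type*) [NormedAddCommGroup F] [NormedSpace 𝕜 F] :
    Bidual 𝕜 (E →L[𝕜] F) →L[𝕜] Bidual 𝕜 E →L[𝕜] Bidual 𝕜 F :=
  dualPostcomp (dualPostcomp (ContinuousLinearMap.compL 𝕜 E F 𝕜))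

/-- `B` extends `A` to the biduals and `B` is weak-star continuous in the `i`-th variable whenever
the variables before the `i`-th one belong to the original spaces. -/
def IsSuccessivelyWeakStarExtension {n : ℕ}
    {E : Fin n → Type*} [∀ i, NormedAddCommGroup (E i)] [∀ i, NormedSpace 𝕜 (E i)]
    {F : Type*} [NormedAddCommGroup F] [NormedSpace 𝕜 F] (A : ContinuousMultilinearMap 𝕜 E F)
    (B : ContinuousMultilinearMap 𝕜 (fun i => Bidual 𝕜 (E i)) (Bidual 𝕜 F)) : Prop :=
  (∀ x : ∀ i, E i, B (fun i => NormedSpace.inclusionInDoubleDual 𝕜 (E i) (x i)) =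
      NormedSpace.inclusionInDoubleDual 𝕜 F (A x)) ∧
    ∀ (i : Fin n) (y : ∀ i, Bidual 𝕜 (E i)),
      (∀ m < i, ∃ x, y m = NormedSpace.inclusionInDoubleDual 𝕜 (E m) x) →
      ∀ φ : StrongDual 𝕜 F, ∃ ψ : StrongDual 𝕜 (E i), ∀ z : Bidual 𝕜 (E i),
        B (Function.update y i z) φ = z ψ

/-- Induction by currying the last variable: the extension of `A.curryRight` takes values in the
bidual of an operator space, and `bidualHomMap` turns these into operators between biduals. The
universe of `F` absorbs that of `E` so that the operator space is again an admissible target. -/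
theorem exists_isSuccessivelyWeakStarExtension_aux (n : ℕ) :
    ∀ (E : Fin n → Type u) [∀ i, NormedAddCommGroup (E i)] [∀ i, NormedSpace 𝕜 (E i)]
      (F : Type max u v) [NormedAddCommGroup F] [NormedSpace 𝕜 F]
      (A : ContinuousMultilinearMap 𝕜 E F), ∃ B, IsSuccessivelyWeakStarExtension A B := by
  induction n with
  | zero =>
    intro E _ _ F _ _ A
    refine ⟨ContinuousMultilinearMap.constOfIsEmpty 𝕜 _
      (NormedSpace.inclusionInDoubleDual 𝕜 F (A default)), fun x => ?_, fun i => i.elim0⟩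
    rw [Subsingleton.elim x default]
    rfl
  | succ n ih =>
    intro E _ _ F _ _ A
    obtain ⟨B, hB, hBψ⟩ := ih (fun i => E i.castSucc) (E (Fin.last n) →L[𝕜] F) A.curryRight
    let B' : ContinuousMultilinearMap 𝕜 (fun i => Bidual 𝕜 (E i)) (Bidual 𝕜 F) :=
      ContinuousMultilinearMap.uncurryRight (Ei := fun i => Bidual 𝕜 (E i))
        ((bidualHomMap 𝕜 (E (Fin.last n)) F).compContinuousMultilinearMap B)
    have hB' : ∀ y φ, B' y φ = B (Fin.init y) ((y (Fin.last n)).comp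
        (ContinuousLinearMap.compL 𝕜 (E (Fin.last n)) F 𝕜 φ)) := fun y φ => rfl
    refine ⟨B', fun x => ?_, fun i y hy φ => ?_⟩
    · ext φ
      have h1 := hB (Fin.init x)
      have h2 : (Fin.init fun i => NormedSpace.inclusionInDoubleDual 𝕜 (E i) (x i)) =
        fun i : Fin n => NormedSpace.inclusionInDoubleDual 𝕜 (E i.castSucc) (Fin.init x i) := rfl
      rw [hB', h2, h1]
      simp only [NormedSpace.dual_def, ContinuousLinearMap.comp_apply,
        ContinuousLinearMap.compL_apply, ContinuousMultilinearMap.curryRight_apply,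
        Fin.snoc_init_self]
    · induction i using Fin.lastCases with
      | last =>
        choose x hx using fun m : Fin n => hy m.castSucc (Fin.castSucc_lt_last m)
        -- With the earlier variables in the original spaces, the value is the bitranspose of the
        -- operator `A.curryRight x` at `z`.
        refine ⟨φ.comp (A.curryRight x), fun z => ?_⟩
        have h2 : Fin.init y = fun i : Fin n =>
            NormedSpace.inclusionInDoubleDual 𝕜 (E i.castSucc) (x i) := funext hx
        rw [hB', Fin.init_update_last, h2, hB x, Function.update_self]
        rfl
      | cast i =>
        obtain ⟨ψ, hψ⟩ := hBψ i (Fin.init y)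
          (fun m hm => hy m.castSucc (Fin.castSucc_lt_castSucc_iff.2 hm))
          ((y (Fin.last n)).comp (ContinuousLinearMap.compL 𝕜 (E (Fin.last n)) F 𝕜 φ))
        refine ⟨ψ, fun z => ?_⟩
        rw [hB', Fin.init_update_castSucc, Function.update_of_ne (Fin.castSucc_lt_last i).ne',
          ← hψ]

variable {n : ℕ} {E : Fin n → Type u} [∀ i, NormedAddCommGroup (E i)]
  [∀ i, NormedSpace 𝕜 (E i)] {F : Type v} [NormedAddCommGroup F] [NormedSpace 𝕜 F]

theorem exists_isSuccessivelyWeakStarExtension (A : ContinuousMultilinearMap 𝕜 E F) :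
    ∃ B, IsSuccessivelyWeakStarExtension A B := by
  -- Lifting `F` meets the universe constraint of the induction; `R` transports functionals back.
  let e : ULift.{u} F →L[𝕜] F := (ContinuousLinearEquiv.ulift : ULift.{u} F ≃L[𝕜] F)
  let e' : F →L[𝕜] ULift.{u} F := (ContinuousLinearEquiv.ulift : ULift.{u} F ≃L[𝕜] F).symm
  obtain ⟨B, hB, hBψ⟩ := exists_isSuccessivelyWeakStarExtension_aux.{u, v} n E (ULift.{u} F)
    (e'.compContinuousMultilinearMap A)
  let R : StrongDual 𝕜 F →L[𝕜] StrongDual 𝕜 (ULift.{u} F) :=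
    (ContinuousLinearMap.compL 𝕜 (ULift.{u} F) F 𝕜).flip e
  refine ⟨((ContinuousLinearMap.compL 𝕜 (StrongDual 𝕜 F) (StrongDual 𝕜 (ULift.{u} F)) 𝕜).flip
    R).compContinuousMultilinearMap B, fun x => ?_, fun i y hy φ => ?_⟩
  · ext φ
    exact DFunLike.congr_fun (hB x) (R φ)
  · exact hBψ i y hy (R φ)

/-- In an increasing list the limit in variable `i` is taken while all smaller variables still lie
in the original spaces, exactly where `B` is weak-star continuous. -/
theorem IsSuccessivelyWeakStarExtension.hasIteratedLim {A : ContinuousMultilinearMap 𝕜 E F}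
    {B : ContinuousMultilinearMap 𝕜 (fun i => Bidual 𝕜 (E i)) (Bidual 𝕜 F)}
    (hAB : IsSuccessivelyWeakStarExtension A B) {y : ∀ i, Bidual 𝕜 (E i)}
    {l : ∀ i, Filter (E i)}
    (hl : ∀ i, Tendsto (bidualEmb 𝕜 (E i)) (l i) (𝓝 (StrongDual.toWeakDual (y i))))
    (is : List (Fin n)) (his : is.Pairwise (· < ·)) :
    HasIteratedLim l (fun x => bidualEmb 𝕜 F (A x)) is (fun x => StrongDual.toWeakDual
      (B fun m => if m ∈ is then y m else NormedSpace.inclusionInDoubleDual 𝕜 (E m) (x m))) := by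
  induction is with
  | nil =>
    funext x
    simp only [List.not_mem_nil, if_false, hAB.1, bidualEmb]
  | cons i is ih =>
    rw [List.pairwise_cons] at his
    refine ⟨_, ih his.2, fun x => ?_⟩
    have hi : i ∉ is := fun h => lt_irrefl i (his.1 i h)
    set y' : ∀ i, Bidual 𝕜 (E i) := fun m =>
      if m ∈ is then y m else NormedSpace.inclusionInDoubleDual 𝕜 (E m) (x m) with hy'
    rw [tendsto_iff_forall_eval_tendsto_topDualPairing]
    intro φ
    obtain ⟨ψ, hψ⟩ := hAB.2 i y' (fun m hm => ⟨x m, by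
      simp [hy', show m ∉ is from fun h => (his.1 m h).not_gt hm]⟩) φ
    have h1 : (fun m => if m ∈ i :: is then y m else
        NormedSpace.inclusionInDoubleDual 𝕜 (E m) (x m)) = Function.update y' i (y i) := by
      ext1 m
      rcases eq_or_ne m i with rfl | hne
      · simp
      · simp [hy', hne]
    have h2 : ∀ t, (fun m => if m ∈ is then y m else
        NormedSpace.inclusionInDoubleDual 𝕜 (E m) (Function.update x i t m)) =
        Function.update y' i (NormedSpace.inclusionInDoubleDual 𝕜 (E i) t) := by
      intro t
      ext1 m
      rcases eq_or_ne m i with rfl | hne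
      · simp [hi]
      · simp [hy', hne]
    simp only [h1, h2]
    have h3 := (tendsto_iff_forall_eval_tendsto_topDualPairing).1 (hl i) ψ
    refine (h3.congr fun t => ?_).trans_eq ?_
    · exact (hψ _).symm
    · exact congrArg 𝓝 (hψ _).symm

theorem exists_isAronBernerExtension (A : ContinuousMultilinearMap 𝕜 E F) :
    ∃ B, IsAronBernerExtension A B := by
  obtain ⟨B, hB⟩ := exists_isSuccessivelyWeakStarExtension A
  refine ⟨B, 1, fun y l _ hl => ?_⟩
  have h := hB.hasIteratedLim hl (List.ofFn (1 : Equiv.Perm (Fin n)))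
    (List.pairwise_ofFn.2 fun i j hij => hij)
  simpa [List.mem_ofFn] using h

end Existence

/-! ### Transfer of type and cotype between `A` and its extensions -/

section Transfer

variable {𝕜 : Type*} [RCLike 𝕜] {n : ℕ} {E : Fin n → Type*} [∀ i, NormedAddCommGroup (E i)]
  [∀ i, NormedSpace 𝕜 (E i)] {F : Type*} [NormedAddCommGroup F] [NormedSpace 𝕜 F]
  {A : ContinuousMultilinearMap 𝕜 E F}
  {B : ContinuousMultilinearMap 𝕜 (fun i => Bidual 𝕜 (E i)) (Bidual 𝕜 F)}

theorem IsAronBernerExtension.apply_inclusionInDoubleDual (hB : IsAronBernerExtension A B)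
    (x : ∀ i, E i) : B (fun i => NormedSpace.inclusionInDoubleDual 𝕜 (E i) (x i)) =
      NormedSpace.inclusionInDoubleDual 𝕜 F (A x) := by
  obtain ⟨σ, hσ⟩ := hB
  have h := HasIteratedLim.eq_of_pure x _ _
    (hσ (fun i => NormedSpace.inclusionInDoubleDual 𝕜 (E i) (x i)) (fun i => pure (x i))
      (fun i => inferInstance) (fun i => tendsto_pure_nhds _ _)) x
  simp only [ite_self] at h
  exact StrongDual.toWeakDual.injective h

theorem IsAronBernerExtension.mem_of_isClosed (hB : IsAronBernerExtension A B) {ι : Type*}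
    {K : Set (ι → WeakDual 𝕜 (StrongDual 𝕜 F))} (hK : IsClosed K)
    {S : ∀ i, Set (ι → E i)} {L : ∀ i, Filter (ι → E i)} (hL : ∀ i, (L i).NeBot)
    (hS : ∀ i, S i ∈ L i)
    (hA : ∀ x : ∀ i, ι → E i, (∀ i, x i ∈ S i) →
      (fun j => bidualEmb 𝕜 F (A fun i => x i j)) ∈ K)
    {y : ∀ i, ι → Bidual 𝕜 (E i)}
    (hy : ∀ i j, Tendsto (fun x => bidualEmb 𝕜 (E i) (x j)) (L i)
      (𝓝 (StrongDual.toWeakDual (y i j)))) :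
    (fun j => StrongDual.toWeakDual (B fun i => y i j)) ∈ K := by
  obtain ⟨σ, hσ⟩ := hB
  -- An arbitrary base point: the final iterated limit is constant in it.
  choose x hx using fun i => (hL i).nonempty_of_mem (hS i)
  exact HasIteratedLim.mem_of_isClosed hK hL hS hA (List.ofFn σ)
    (fun j _ => StrongDual.toWeakDual (B fun i => y i j))
    (fun j => hσ (fun i => y i j) _ (fun i => (hL i).map _)
      (fun i => tendsto_map'_iff.2 (hy i j))) x hx

theorem HasMultiType.of_isAronBernerExtension {p : Fin n → ℝ} (hp : ∀ i, 0 < p i)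
    (hA : HasMultiType p A) (hB : IsAronBernerExtension A B) :
    HasMultiType (𝕜 := 𝕜) (E := fun i => Bidual 𝕜 (E i)) (F := Bidual 𝕜 F) p B := by
  obtain ⟨C, hC, hA⟩ := hA
  refine ⟨C, hC, fun k y => ?_⟩
  choose L hL hy hS using fun i => exists_filter_tendsto_lpSeqNorm_le (hp i) (y i)
  refine hB.mem_of_isClosed (isClosed_radNorm_le 𝕜 k (C * ∏ i, lpSeqNorm (p i) (y i))) hL hS
    (fun x hx => ?_) hy
  refine (radNorm_inclusionInDoubleDual 𝕜 fun j => A fun i => x i j).trans_le ((hA k x).trans ?_)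
  exact mul_le_mul_of_nonneg_left
    (Finset.prod_le_prod (fun i _ => lpSeqNorm_nonneg _ _) fun i _ => hx i) hC.le

theorem HasMultiCotype.of_isAronBernerExtension {q : ℝ} (hq : 0 < q)
    (hA : HasMultiCotype q A) (hB : IsAronBernerExtension A B) :
    HasMultiCotype (𝕜 := 𝕜) (E := fun i => Bidual 𝕜 (E i)) (F := Bidual 𝕜 F) q B := by
  obtain ⟨C, hC, hA⟩ := hA
  refine ⟨C, hC, fun k y => ?_⟩
  -- Rademacher approximation needs a radius strictly above the norm; the excess `δ` then tends to
  -- `0`.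
  have hδ : ∀ δ > 0, lpSeqNorm q (fun j => B fun i => y i j) ≤
      C * ∏ i, (radNorm 𝕜 (y i) + δ) := by
    intro δ hδ
    choose L hL hy hS using fun i =>
      exists_filter_tendsto_radNorm_le (y i) (lt_add_of_pos_right (radNorm 𝕜 (y i)) hδ)
    refine hB.mem_of_isClosed (isClosed_lpSeqNorm_le 𝕜 hq k _) hL hS (fun x hx => ?_) hy
    refine (lpSeqNorm_inclusionInDoubleDual 𝕜 q fun j => A fun i => x i j).trans_le
      ((hA k x).trans ?_)
    exact mul_le_mul_of_nonneg_left
      (Finset.prod_le_prod (fun i _ => radNorm_nonneg 𝕜 _) fun i _ => hx i) hC.le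
  have hlim : Tendsto (fun δ : ℝ => C * ∏ i, (radNorm 𝕜 (y i) + δ)) (𝓝[>] 0)
      (𝓝 (C * ∏ i, (radNorm 𝕜 (y i) + 0))) :=
    (Continuous.tendsto (by fun_prop) _).mono_left nhdsWithin_le_nhds
  simp only [add_zero] at hlim
  exact ge_of_tendsto hlim (eventually_mem_nhdsWithin.mono hδ)

theorem HasMultiType.of_extension {p : Fin n → ℝ} (hB : IsAronBernerExtension A B)
    (h : HasMultiType (𝕜 := 𝕜) (E := fun i => Bidual 𝕜 (E i)) (F := Bidual 𝕜 F) p B) :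
    HasMultiType p A := by
  obtain ⟨C, hC, h⟩ := h
  refine ⟨C, hC, fun k x => ?_⟩
  have := h k fun i j => NormedSpace.inclusionInDoubleDual 𝕜 (E i) (x i j)
  simpa only [hB.apply_inclusionInDoubleDual, lpSeqNorm_inclusionInDoubleDual,
    radNorm_inclusionInDoubleDual] using this

theorem HasMultiCotype.of_extension {q : ℝ} (hB : IsAronBernerExtension A B)
    (h : HasMultiCotype (𝕜 := 𝕜) (E := fun i => Bidual 𝕜 (E i)) (F := Bidual 𝕜 F) q B) :
    HasMultiCotype q A := by
  obtain ⟨C, hC, h⟩ := h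
  refine ⟨C, hC, fun k x => ?_⟩
  have := h k fun i j => NormedSpace.inclusionInDoubleDual 𝕜 (E i) (x i j)
  simpa only [hB.apply_inclusionInDoubleDual, lpSeqNorm_inclusionInDoubleDual,
    radNorm_inclusionInDoubleDual] using this

end Transfer

end

theorem corollary4p2 {𝕜 : Type*} [RCLike 𝕜] {n : ℕ} (hn : 2 ≤ n)
    {E : Fin n → Type*} [∀ i, NormedAddCommGroup (E i)] [∀ i, NormedSpace 𝕜 (E i)]
    [∀ i, CompleteSpace (E i)]
    {F : Type*} [NormedAddCommGroup F] [NormedSpace 𝕜 F] [CompleteSpace F]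
    (p : Fin n → ℝ) (hp : IsProperType p) (q : ℝ) (hq : IsProperCotype n q)
    (A : ContinuousMultilinearMap 𝕜 E F) :
    [HasMultiType p A,
      ∀ B : ContinuousMultilinearMap 𝕜 (fun i => Bidual 𝕜 (E i)) (Bidual 𝕜 F),
        IsAronBernerExtension A B →
          HasMultiType (𝕜 := 𝕜) (E := fun i => Bidual 𝕜 (E i)) (F := Bidual 𝕜 F) p B,
      ∃ B : ContinuousMultilinearMap 𝕜 (fun i => Bidual 𝕜 (E i)) (Bidual 𝕜 F),
        IsAronBernerExtension A B ∧
          HasMultiType (𝕜 := 𝕜) (E := fun i => Bidual 𝕜 (E i)) (F := Bidual 𝕜 F) p B].TFAE ∧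
    [HasMultiCotype q A,
      ∀ B : ContinuousMultilinearMap 𝕜 (fun i => Bidual 𝕜 (E i)) (Bidual 𝕜 F),
        IsAronBernerExtension A B →
          HasMultiCotype (𝕜 := 𝕜) (E := fun i => Bidual 𝕜 (E i)) (F := Bidual 𝕜 F) q B,
      ∃ B : ContinuousMultilinearMap 𝕜 (fun i => Bidual 𝕜 (E i)) (Bidual 𝕜 F),
        IsAronBernerExtension A B ∧
          HasMultiCotype (𝕜 := 𝕜) (E := fun i => Bidual 𝕜 (E i)) (F := Bidual 𝕜 F) q B].TFAE := by
  constructor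
  · tfae_have 1 → 2 := fun h B hB => h.of_isAronBernerExtension hp.1 hB
    tfae_have 2 → 3 := fun h =>
      let ⟨B, hB⟩ := exists_isAronBernerExtension A
      ⟨B, hB, h B hB⟩
    tfae_have 3 → 1 := fun ⟨_, hB, h⟩ => HasMultiType.of_extension hB h
    tfae_finish
  · tfae_have 1 → 2 := fun h B hB => h.of_isAronBernerExtension hq.1 hB
    tfae_have 2 → 3 := fun h =>
      let ⟨B, hB⟩ := exists_isAronBernerExtension A
      ⟨B, hB, h B hB⟩
    tfae_have 3 → 1 := fun ⟨_, hB, h⟩ => HasMultiCotype.of_extension hB h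
    tfae_finish
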